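/- Let $A,d\ge 1$ be integers, $\mathcal A=\{1,\dots,A\}$, let $\Delta(\mathcal A)$ be the set of probability vectors on $\mathcal A$, let $K\subset(\mathbb R^{d})^{A}$ be a non-empty compact convex set, let $\mathcal C\subseteq\mathbb R^d$ be non-empty, and let $0<p\le\infty$. For $r\in\mathbb R^d$ let $\mathrm d_p(r,\mathcal C)=\inf_{c\in\mathcal C}\|r-c\|_p$, and for $\alpha\ge 0$ let $\mathcal C_\alpha=\{r\in\mathbb R^d:\mathrm d_p(r,\mathcal C)\le\alpha\}$. At each round $t=1,2,\dots$ the decision-maker picks $x_t\in\Delta(\mathcal A)$ as a function of $m_1,\dots,m_{t-1}$ while the opponent picks $m_t=(m_{t,a})_{a\in\mathcal A}\in K$. Put $x_t\odot m_t=\sum_{a}x_{t,a}m_{t,a}$, $\overline m_T=\frac1T\sum_{t\le T}m_t$ and $\overline r_T=\frac1T\sum_{t\le T}x_t\odot m_t$. A target function is a function $\varphi:K\to[0,+\infty)$ whose graph $\mathcal G_\varphi=\{(m,r)\in K\times\mathbb R^d: r\in\mathcal C_{\varphi(m)}\}$ is closed (this is the case, for instance, when $\varphi$ is upper semicontinuous).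 It is achievable if the decision-maker has a strategy such that, for all choices of $m_1,m_2,\dots\in K$ by the opponent, the distance of $(\overline m_T,\overline r_T)$ to $\mathcal G_\varphi$ tends to $0$ as $T\to\infty$. Write $\varphi\prec\varphi'$ if $\varphi\le\varphi'$ on $K$ and $\varphi(m)<\varphi'(m)$ for some $m\in K$. An achievable target function $\varphi$ is admissible if there is no achievable target function $\varphi'$ with $\varphi'\prec\varphi$. Then there always exists an admissible target function. -/

import Mathlib

open Filter Topology
open scoped ENNReal NNReal

/-- Vectors of vector payoffs `m = (m_a)_{a ∈ 𝒜}`, with `m_a ∈ ℝ^d` and `𝒜` of cardinality `A`. -/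
abbrev PayoffVec (A d : ℕ) : Type := Fin A → Fin d → ℝ

/-- `x ⊙ m = ∑_a x_a m_a`. -/
def odot {A d : ℕ} (x : Fin A → ℝ) (m : PayoffVec A d) : Fin d → ℝ :=
  ∑ a, x a • m a

/-- A strategy of the decision-maker: a mixed action for each round, as a function of the vectors
of vector payoffs chosen by the opponent in the previous rounds.  Rounds are numbered from `0`. -/
abbrev Strategy (A d : ℕ) : Type :=
  (t : ℕ) → (Fin t → PayoffVec A d) → stdSimplex ℝ (Fin A)

/-- The average `(1/T) ∑_t m_t` of the first `T` vectors of vector payoffs. -/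
noncomputable def avgVec {A d : ℕ} (m : ℕ → PayoffVec A d) (T : ℕ) : PayoffVec A d :=
  (T : ℝ)⁻¹ • ∑ t ∈ Finset.range T, m t

/-- The average `(1/T) ∑_t x_t ⊙ m_t` of the first `T` payoffs when the decision-maker plays `σ`
and the opponent chooses the sequence `m`. -/
noncomputable def avgPayoff {A d : ℕ} (σ : Strategy A d) (m : ℕ → PayoffVec A d) (T : ℕ) :
    Fin d → ℝ :=
  (T : ℝ)⁻¹ • ∑ t ∈ Finset.range T, odot (σ t fun s => m s : Fin A → ℝ) (m t)

/-- The distance in `ℓ_p`-norm from `r` to the set `C`. -/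
noncomputable def lpDistSet {d : ℕ} (p : ℝ≥0∞) (r : Fin d → ℝ) (C : Set (Fin d → ℝ)) : ℝ :=
  ⨅ c : C, ‖WithLp.toLp p (r - (c : Fin d → ℝ))‖

/-- The `α`-expansion `C_α` of `C` in `ℓ_p`-norm. -/
def expansion {d : ℕ} (p : ℝ≥0∞) (C : Set (Fin d → ℝ)) (α : ℝ≥0) : Set (Fin d → ℝ) :=
  {r | lpDistSet p r C ≤ α}

/-- The graph `{(m, r) : m ∈ K, r ∈ C_{φ(m)}}` of the set-valued mapping `m ∈ K ↦ C_{φ(m)}`. -/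
def targetGraph {A d : ℕ} (p : ℝ≥0∞) (C : Set (Fin d → ℝ)) {K : Set (PayoffVec A d)}
    (φ : K → ℝ≥0) : Set (PayoffVec A d × (Fin d → ℝ)) :=
  {z | ∃ h : z.1 ∈ K, z.2 ∈ expansion p C (φ ⟨z.1, h⟩)}

/-- The target function `φ : K → [0, ∞)` is achievable: the decision-maker has a strategy which
ensures, whatever the opponent does, that the pair of averages converges to the graph of `φ`.
As strategies are deterministic maps of the observed history, the plays against all strategies
of the opponent are the plays against all sequences in `K`. -/
def Achievable {A d : ℕ} (p : ℝ≥0∞) (C : Set (Fin d → ℝ)) {K : Set (PayoffVec A d)}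
    (φ : K → ℝ≥0) : Prop :=
  ∃ σ : Strategy A d, ∀ m : ℕ → PayoffVec A d, (∀ t, m t ∈ K) →
    Tendsto (fun T => Metric.infDist (avgVec m T, avgPayoff σ m T) (targetGraph p C φ))
      atTop (𝓝 0)

/-- `φ ≺ φ'`: `φ` is strictly smaller than `φ'`. -/
def StrictlySmaller {A d : ℕ} {K : Set (PayoffVec A d)} (φ φ' : K → ℝ≥0) : Prop :=
  (∀ m, φ m ≤ φ' m) ∧ ∃ m, φ m < φ' m

/-- `φ` is admissible: it is an achievable target function and no achievable target function is
strictly smaller.  Target functions are here those whose graph is closed: the distance to a set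
only sees its closure, so that without this requirement a function could be decreased at single
points without affecting achievability. -/
def Admissible {A d : ℕ} (p : ℝ≥0∞) (C : Set (Fin d → ℝ)) {K : Set (PayoffVec A d)}
    (φ : K → ℝ≥0) : Prop :=
  IsClosed (targetGraph p C φ) ∧ Achievable p C φ ∧
    ¬ ∃ φ' : K → ℝ≥0,
      IsClosed (targetGraph p C φ') ∧ Achievable p C φ' ∧ StrictlySmaller φ' φ

/-! By Zorn's lemma, it is enough that the infimum of a chain of achievable target functions with
closed graphs is of the same kind; a large constant shows that such functions exist. The graph of
the infimum is the intersection `G` of the graphs. By compactness, for every ε the bounded part of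
some graph of the chain is within ε of `G`, so `G` is approachable up to every positive error
(`achievable_iInf`).

The crux is to remove the error (`exists_strategy_of_forall_pos`). As `G` need not be convex,
playing better and better strategies in successive blocks does not work: a mean of points of `G` may
be far from `G`. Instead, consider the positions from which the average can be kept ε-close to `G`
forever (`Safe`). They exist at arbitrarily late times (`exists_safe`), and the limits of their
averages form a non-empty compact set `safeLimit` of points at distance 0 from `G`. This set
satisfies Blackwell's condition (`isBlackwellSet_safeLimit`), so the projection strategy approaches
it. -/

/-- The sum of the first `n` payoffs when the decision-maker plays `σ` and the opponent `y`. -/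
def playSum {X Y V : Type*} [AddCommMonoid V] (g : X → Y → V) (σ : (t : ℕ) → (Fin t → Y) → X)
    (y : ℕ → Y) (n : ℕ) : V :=
  ∑ t ∈ Finset.range n, g (σ t fun s => y s) (y t)

/-- The state after `n` rounds when the decision-maker uses the feedback rule `f`. -/
def feedbackState {X Y V : Type*} [AddCommMonoid V] (g : X → Y → V) (f : ℕ → V → X)
    (y : ℕ → Y) : ℕ → V
  | 0 => 0
  | n + 1 => feedbackState g f y n + g (f n (feedbackState g f y n)) (y n)

/-- From cumulative payoff `w` after `n` rounds, the decision-maker can keep the average payoff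
within `ε` of `G` forever. -/
def Safe {X Y V : Type*} [NormedAddCommGroup V] [NormedSpace ℝ V] (g : X → Y → V) (G : Set V)
    (R ε : ℝ) (n : ℕ) (w : V) : Prop :=
  ∃ P : ℕ → Set V, w ∈ P n ∧ ∀ k, ∀ v ∈ P k,
    ‖v‖ ≤ k * R ∧ Metric.infDist ((k : ℝ)⁻¹ • v) G ≤ ε ∧ ∃ x, ∀ y, v + g x y ∈ P (k + 1)

/-- Limits of averages at safe positions, for tolerances tending to `0` and times tending to
infinity. -/
def safeLimit {X Y V : Type*} [NormedAddCommGroup V] [NormedSpace ℝ V] (g : X → Y → V) (G : Set V)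
    (R : ℝ) : Set V :=
  {s | ∀ ε > 0, ∀ N₀ : ℕ, ∃ N ≥ N₀, ∃ w, Safe g G R ε N w ∧ ‖(N : ℝ)⁻¹ • w - s‖ < ε}

/-- An approximate form of Blackwell's geometric condition. -/
def IsBlackwellSet {X Y V : Type*} [NormedAddCommGroup V] [InnerProductSpace ℝ V] (g : X → Y → V)
    (S : Set V) : Prop :=
  ∀ z, ∀ s ∈ S, (∀ s' ∈ S, ‖z - s‖ ≤ ‖z - s'‖) → ∀ δ > 0, ∃ x, ∀ y,
    inner ℝ (z - s) (g x y - s) ≤ δ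

/-! ### Strategies, feedback rules and finite prefixes of plays. -/

section Play

variable {X Y V : Type*}

theorem playSum_congr [AddCommMonoid V] (g : X → Y → V) (σ : (t : ℕ) → (Fin t → Y) → X)
    {y y' : ℕ → Y} {n : ℕ} (h : ∀ i < n, y i = y' i) : playSum g σ y n = playSum g σ y' n := by
  refine Finset.sum_congr rfl fun t ht => ?_
  have ht := Finset.mem_range.1 ht
  have : (fun s : Fin t => y s) = fun s : Fin t => y' s :=
    funext fun s => h s (s.2.trans ht)
  rw [this, h t ht]

theorem feedbackState_congr [AddCommMonoid V] (g : X → Y → V) (f : ℕ → V → X)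
    {y y' : ℕ → Y} {n : ℕ} (h : ∀ i < n, y i = y' i) :
    feedbackState g f y n = feedbackState g f y' n := by
  induction n with
  | zero => rfl
  | succ n ih =>
    simp only [feedbackState]
    rw [ih fun i hi => h i (by omega), h n (by omega)]

theorem exists_strategy_of_feedback [AddCommMonoid V] [Nonempty Y] (g : X → Y → V)
    (f : ℕ → V → X) :
    ∃ σ : (t : ℕ) → (Fin t → Y) → X, ∀ y n, playSum g σ y n = feedbackState g f y n := by
  classical
  obtain ⟨y₀⟩ := ‹Nonempty Y›
  -- The filler `y₀` is harmless: the state after `t` rounds depends on the first `t` moves only.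
  refine ⟨fun t h => f t (feedbackState g f (fun i => if hi : i < t then h ⟨i, hi⟩ else y₀) t),
    fun y n => ?_⟩
  induction n with
  | zero => simp [playSum, feedbackState]
  | succ n ih =>
    rw [playSum] at ih ⊢
    rw [Finset.sum_range_succ, ih, feedbackState]
    congr 3
    refine feedbackState_congr g f fun i hi => ?_
    simp [hi]

theorem norm_playSum_le [NormedAddCommGroup V] {g : X → Y → V} {R : ℝ} (hg : ∀ x y, ‖g x y‖ ≤ R)
    (σ : (t : ℕ) → (Fin t → Y) → X) (y : ℕ → Y) (n : ℕ) : ‖playSum g σ y n‖ ≤ n * R := by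
  refine (norm_sum_le_of_le _ fun t _ => hg _ _).trans ?_
  simp

/-- If a property of finite plays holds eventually along every play, then every finite play
can be extended to one after which it holds forever. -/
theorem exists_prefix_forall {Q : (ℕ → Y) → ℕ → Prop}
    (hcongr : ∀ (y y' : ℕ → Y) (n : ℕ), (∀ i < n, y i = y' i) → Q y n → Q y' n)
    (hQ : ∀ y, ∀ᶠ n in atTop, Q y n) (y₀ : ℕ → Y) (N₀ : ℕ) :
    ∃ y : ℕ → Y, ∃ N ≥ N₀, ∀ y' : ℕ → Y, (∀ i < N, y i = y' i) → ∀ n ≥ N, Q y' n := by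
  -- Otherwise every prefix can be extended to a later failure of `Q`. Iterating gives prefixes that
  -- agree further and further, and along their diagonal limit `Q` fails infinitely often.
  by_contra! hbad
  choose! F hF n hn hnQ using hbad
  let step : (ℕ → Y) × ℕ → (ℕ → Y) × ℕ := fun q => (F q.1 (q.2 + 1), n q.1 (q.2 + 1))
  let u : ℕ → (ℕ → Y) × ℕ := fun k => step^[k] (y₀, N₀)
  have hu : ∀ k, u (k + 1) = step (u k) := fun k => Function.iterate_succ_apply' step k _
  have hN : ∀ k, N₀ ≤ (u k).2 := by
    intro k
    induction k with
    | zero => exact le_rfl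
    | succ k ih =>
      rw [hu]
      have := hn (u k).1 ((u k).2 + 1) (by omega)
      simp only [step]; omega
  have hlt : ∀ k, (u k).2 + 1 ≤ (u (k + 1)).2 := by
    intro k
    rw [hu]
    exact hn _ _ (by have := hN k; omega)
  have hmono : StrictMono fun k => (u k).2 := strictMono_nat_of_lt_succ hlt
  have hagree : ∀ k i, i ≤ (u k).2 → (u (k + 1)).1 i = (u k).1 i := by
    intro k i hi
    rw [hu]
    exact (hF (u k).1 ((u k).2 + 1) (by have := hN k; omega) i (by omega)).symm
  have hagree' : ∀ k j i, k ≤ j → i ≤ (u k).2 → (u j).1 i = (u k).1 i := by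
    intro k j i hkj hi
    induction j, hkj using Nat.le_induction with
    | base => rfl
    | succ j hj ih =>
      rw [hagree j i (hi.trans (hmono.monotone hj)), ih]
  have hlim : ∀ k i, i < (u k).2 → (u k).1 i = (u i).1 i := by
    intro k i hi
    rcases le_total k i with h | h
    · exact (hagree' k i i h hi.le).symm
    · exact hagree' i k i h (hmono.id_le i)
  obtain ⟨M, hM⟩ := eventually_atTop.1 (hQ fun i => (u i).1 i)
  have hM' : M ≤ (u (M + 1)).2 := (Nat.le_succ M).trans (hmono.id_le (M + 1))
  have h1 := hM _ hM'
  have h2 : ¬ Q (u (M + 1)).1 (u (M + 1)).2 := by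
    rw [hu]
    exact hnQ _ _ (by have := hN M; omega)
  exact h2 (hcongr _ _ _ (fun i hi => (hlim _ i hi).symm) h1)

end Play

/-! ### Safe positions and the limits of their averages. -/

section Normed

variable {X Y V : Type*} [NormedAddCommGroup V] [NormedSpace ℝ V] {g : X → Y → V} {G : Set V}
  {R : ℝ}

theorem Safe.mono {ε ε' : ℝ} {n : ℕ} {w : V} (h : Safe g G R ε n w) (hε : ε ≤ ε') :
    Safe g G R ε' n w := by
  obtain ⟨P, hw, hP⟩ := h
  exact ⟨P, hw, fun k v hv => ⟨(hP k v hv).1, (hP k v hv).2.1.trans hε, (hP k v hv).2.2⟩⟩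

theorem Safe.norm_le {ε : ℝ} {n : ℕ} {w : V} (h : Safe g G R ε n w) : ‖w‖ ≤ n * R := by
  obtain ⟨P, hw, hP⟩ := h
  exact (hP n w hw).1

theorem Safe.infDist_le {ε : ℝ} {n : ℕ} {w : V} (h : Safe g G R ε n w) :
    Metric.infDist ((n : ℝ)⁻¹ • w) G ≤ ε := by
  obtain ⟨P, hw, hP⟩ := h
  exact (hP n w hw).2.1

theorem Safe.step {ε : ℝ} {n : ℕ} {w : V} (h : Safe g G R ε n w) :
    ∃ x, ∀ y, Safe g G R ε (n + 1) (w + g x y) := by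
  obtain ⟨P, hw, hP⟩ := h
  obtain ⟨x, hx⟩ := (hP n w hw).2.2
  exact ⟨x, fun y => ⟨P, hx y, hP⟩⟩

theorem Safe.norm_avg_le {ε : ℝ} {n : ℕ} {w : V} (hR : 0 ≤ R) (h : Safe g G R ε n w) :
    ‖(n : ℝ)⁻¹ • w‖ ≤ R := by
  rw [norm_smul, norm_inv, Real.norm_natCast]
  rcases Nat.eq_zero_or_pos n with rfl | hn
  · simpa
  · rw [inv_mul_le_iff₀ (by positivity)]
    exact h.norm_le

/-- The invariant sets are the positions that `σ` reaches on plays extending a prefix after which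
the error stays at most `ε`. -/
theorem exists_safe [Nonempty Y] (hg : ∀ x y, ‖g x y‖ ≤ R) {ε : ℝ}
    {σ : (t : ℕ) → (Fin t → Y) → X}
    (hσ : ∀ y, ∀ᶠ n : ℕ in atTop, Metric.infDist ((n : ℝ)⁻¹ • playSum g σ y n) G ≤ ε) (N₀ : ℕ) :
    ∃ N ≥ N₀, ∃ w, Safe g G R ε N w := by
  classical
  obtain ⟨y₀⟩ := ‹Nonempty Y›
  obtain ⟨y, N, hN, hy⟩ := exists_prefix_forall
    (Q := fun y n => Metric.infDist ((n : ℝ)⁻¹ • playSum g σ y n) G ≤ ε)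
    (fun y y' n h hq => by rwa [← playSum_congr g σ h]) hσ (fun _ => y₀) N₀
  refine ⟨N, hN, playSum g σ y N,
    fun k => {v | N ≤ k ∧ ∃ y', (∀ i < N, y i = y' i) ∧ v = playSum g σ y' k},
    ⟨le_rfl, y, fun _ _ => rfl, rfl⟩, ?_⟩
  rintro k _ ⟨hk, y', hy', rfl⟩
  refine ⟨norm_playSum_le hg σ y' k, hy y' hy' k hk, σ k fun s => y' s, fun b => ⟨by omega,
    Function.update y' k b, fun i hi => ?_, ?_⟩⟩
  · rw [Function.update_of_ne (by omega), hy' i hi]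
  · rw [playSum, playSum, Finset.sum_range_succ, Function.update_self]
    have h1 : ∀ i < k, y' i = Function.update y' k b i := fun i hi => by
      rw [Function.update_of_ne (by omega)]
    have h2 : (fun s : Fin k => y' s) = fun s : Fin k => Function.update y' k b s :=
      funext fun s => h1 s s.2
    have h3 := playSum_congr g σ h1
    rw [playSum, playSum] at h3
    rw [h3, ← h2]

theorem isClosed_safeLimit : IsClosed (safeLimit g G R) := by
  refine isClosed_of_closure_subset fun s hs ε hε N₀ => ?_
  obtain ⟨s', hs', hd⟩ := Metric.mem_closure_iff.1 hs (ε / 2) (by positivity)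
  obtain ⟨N, hN, w, hw, hd'⟩ := hs' (ε / 2) (by positivity) N₀
  refine ⟨N, hN, w, hw.mono (by linarith), ?_⟩
  rw [dist_comm, dist_eq_norm] at hd
  calc ‖(N : ℝ)⁻¹ • w - s‖ = ‖((N : ℝ)⁻¹ • w - s') + (s' - s)‖ := by congr 1; abel
    _ ≤ _ := norm_add_le _ _
    _ < ε := by linarith

theorem safeLimit_infDist {s : V} (hs : s ∈ safeLimit g G R) : Metric.infDist s G = 0 := by
  refine le_antisymm (le_of_forall_pos_le_add fun ε hε => ?_) Metric.infDist_nonneg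
  obtain ⟨N, -, w, hw, hd⟩ := hs (ε / 2) (by positivity) 0
  have h1 := hw.infDist_le
  have h2 := Metric.infDist_le_infDist_add_dist (s := G) (x := s) (y := (N : ℝ)⁻¹ • w)
  rw [dist_comm, dist_eq_norm] at h2
  linarith

theorem norm_le_of_mem_safeLimit (hR : 0 ≤ R) {s : V} (hs : s ∈ safeLimit g G R) : ‖s‖ ≤ R := by
  refine le_of_forall_pos_le_add fun ε hε => ?_
  obtain ⟨N, -, w, hw, hd⟩ := hs ε hε 0
  have h1 := hw.norm_avg_le hR
  have h2 := norm_sub_norm_le s ((N : ℝ)⁻¹ • w)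
  rw [norm_sub_rev] at h2
  linarith

/-- Averages at safe positions are bounded, hence have cluster points. It is applied with the whole
space for `F`, to get non-emptiness, and with a ball, to get a point closer to `z`. -/
theorem exists_mem_safeLimit [ProperSpace V] (hR : 0 ≤ R) {F : Set V} (hF : IsClosed F)
    (h : ∀ ε > 0, ∀ N₀ : ℕ, ∃ N ≥ N₀, ∃ w, Safe g G R ε N w ∧ (N : ℝ)⁻¹ • w ∈ F) :
    ∃ s ∈ safeLimit g G R, s ∈ F := by
  have h' : ∀ k : ℕ, ∃ N ≥ k, ∃ w, Safe g G R (1 / ((k : ℝ) + 1)) N w ∧ (N : ℝ)⁻¹ • w ∈ F :=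
    fun k => h _ (by positivity) k
  choose N hN w hw hwF using h'
  obtain ⟨s, hs, θ, hθ, hlim⟩ := ((isCompact_closedBall (0 : V) R).inter_right hF).tendsto_subseq
    (x := fun k => (N k : ℝ)⁻¹ • w k)
    fun k => ⟨by simpa using (hw k).norm_avg_le hR, hwF k⟩
  refine ⟨s, fun ε hε N₀ => ?_, hs.2⟩
  have h1 := Metric.tendsto_atTop.1 hlim ε hε
  obtain ⟨k₁, hk₁⟩ := h1
  obtain ⟨k₂, hk₂⟩ := exists_nat_one_div_lt hε
  let k := max k₁ (max k₂ N₀)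
  have hθk : k ≤ θ k := hθ.id_le k
  refine ⟨N (θ k), ?_, w (θ k), (hw _).mono ?_, ?_⟩
  · have := hN (θ k)
    have : N₀ ≤ k := by simp [k]
    omega
  · refine le_trans ?_ hk₂.le
    have : k₂ ≤ θ k := le_trans (by simp [k]) hθk
    exact Nat.one_div_le_one_div this
  · have := hk₁ k (by simp [k])
    rwa [dist_eq_norm] at this

end Normed

/-! ### Blackwell's condition and approachability in Euclidean geometry. -/

section Inner

variable {X Y V : Type*} [NormedAddCommGroup V] [InnerProductSpace ℝ V] {g : X → Y → V} {G : Set V}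
  {R : ℝ}

/-- If the opponent can always push the payoff in the direction `e`, then safe positions can be
pushed in that direction for any number of rounds. -/
theorem Safe.push {ε δ : ℝ} {N : ℕ} {w s e : V} (h : Safe g G R ε N w)
    (hg : ∀ x y, ‖g x y‖ ≤ R) (hpush : ∀ x, ∃ y, δ ≤ inner ℝ e (g x y - s)) (k : ℕ) :
    ∃ q, Safe g G R ε (N + k) (w + q) ∧ k * δ ≤ inner ℝ e (q - (k : ℝ) • s) ∧ ‖q‖ ≤ k * R := by
  induction k with
  | zero => exact ⟨0, by simpa using h, by simp, by simp⟩
  | succ k ih =>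
    obtain ⟨q, hq, hi, hn⟩ := ih
    obtain ⟨x, hx⟩ := hq.step
    obtain ⟨y, hy⟩ := hpush x
    refine ⟨q + g x y, by simpa [add_assoc] using hx y, ?_, ?_⟩
    · have : q + g x y - ((k + 1 : ℕ) : ℝ) • s = (q - (k : ℝ) • s) + (g x y - s) := by
        push_cast
        module
      rw [this, inner_add_right]
      push_cast
      linarith
    · refine (norm_add_le _ _).trans ?_
      push_cast
      linarith [hg x y]

/-- Here `b` is the old average and `q` the average over the pushed rounds, both relative to `s`,
and `l` is the weight of the new rounds. The gain is linear in `l` and the loss quadratic, so a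
small `l` brings the average closer to `z`. -/
theorem norm_sub_sq_le_of_push {a b q e : V} {l ε δ B : ℝ} (hl0 : 0 ≤ l) (hl1 : l ≤ 1)
    (ha : a = (1 - l) • b + l • q) (hb : ‖b‖ ≤ ε) (hq : ‖q‖ ≤ B) (hδ : δ ≤ inner ℝ e q) :
    ‖e - a‖ ^ 2 ≤ ‖e‖ ^ 2 + 2 * ‖e‖ * ε - 2 * l * δ + 2 * ε ^ 2 + 2 * (l * B) ^ 2 := by
  have hε : 0 ≤ ε := (norm_nonneg b).trans hb
  have hna : ‖a‖ ≤ ε + l * B := by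
    rw [ha]
    refine (norm_add_le _ _).trans ?_
    rw [norm_smul, norm_smul, Real.norm_of_nonneg hl0, Real.norm_of_nonneg (by linarith)]
    have := mul_le_mul_of_nonneg_left hq hl0
    have := mul_le_mul (show 1 - l ≤ 1 by linarith) hb (norm_nonneg _) zero_le_one
    linarith
  have hea : l * δ - ‖e‖ * ε ≤ inner ℝ e a := by
    rw [ha, inner_add_right, inner_smul_right, inner_smul_right]
    have h1 := mul_le_mul_of_nonneg_left hδ hl0
    have h2 := neg_le_of_abs_le (abs_real_inner_le_norm e b)
    have h3 : ‖e‖ * ‖b‖ ≤ ‖e‖ * ε := mul_le_mul_of_nonneg_left hb (norm_nonneg _)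
    have h4 : 0 ≤ ‖e‖ * ε := by positivity
    nlinarith
  have hsq : ‖a‖ ^ 2 ≤ (ε + l * B) ^ 2 := by gcongr
  rw [norm_sub_sq_real]
  nlinarith [sq_nonneg (ε - l * B)]

/-- If the condition failed at `z` with nearest point `s`, the opponent could push safe positions
with average near `s` towards `z` while they stay safe. A gain independent of `N` survives in the
limit and contradicts the minimality of `s`. -/
theorem isBlackwellSet_safeLimit [ProperSpace V] (hR : 0 ≤ R) (hg : ∀ x y, ‖g x y‖ ≤ R) :
    IsBlackwellSet g (safeLimit g G R) := by
  intro z s hs hmin δ hδ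
  by_contra! hcon
  have hpush : ∀ x, ∃ y, δ ≤ inner ℝ (z - s) (g x y - s) := fun x =>
    (hcon x).imp fun y hy => hy.le
  have hsR := norm_le_of_mem_safeLimit hR hs
  set e := z - s with he
  -- With `k = N / M + 1` new rounds, the weight `l` lies between `1 / (M + 1)` and `2 / M`. The
  -- upper bound makes the quadratic loss at most `l * δ`, half of the linear gain; the lower bound
  -- gives `η ≤ l * δ`, uniformly in `N`.
  obtain ⟨M, hM⟩ := exists_nat_gt (max 1 (16 * R ^ 2 / δ))
  have hM1 : (1 : ℝ) < M := (le_max_left _ _).trans_lt hM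
  have hM2 : 16 * R ^ 2 < M * δ := (div_lt_iff₀ hδ).1 ((le_max_right _ _).trans_lt hM)
  have hM0 : 0 < M := by
    have : (0 : ℝ) < M := by linarith
    exact_mod_cast this
  set η : ℝ := δ / (M + 1) with hη
  have hηpos : 0 < η := by positivity
  obtain ⟨ε₀, hε₀, hε₀'⟩ : ∃ ε₀ > 0, 2 * ‖e‖ * ε₀ + 2 * ε₀ ^ 2 ≤ η / 2 := by
    have hc : Tendsto (fun t : ℝ => 2 * ‖e‖ * t + 2 * t ^ 2) (𝓝[>] 0) (𝓝 0) := by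
      have : Continuous fun t : ℝ => 2 * ‖e‖ * t + 2 * t ^ 2 := by fun_prop
      simpa using (this.tendsto 0).mono_left nhdsWithin_le_nhds
    obtain ⟨t, ht, ht'⟩ := ((hc.eventually_le_const (show (0 : ℝ) < η / 2 by positivity)).and
      self_mem_nhdsWithin).exists
    exact ⟨t, ht', ht⟩
  obtain ⟨s', hs', hs'F⟩ := exists_mem_safeLimit (g := g) (G := G) hR
    (F := {v | ‖z - v‖ ^ 2 ≤ ‖e‖ ^ 2 - η / 2})
    (isClosed_le (by fun_prop) continuous_const) (by
      intro ε hε N₀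
      obtain ⟨N, hN, w, hw, hd⟩ := hs (min ε ε₀) (lt_min hε hε₀) (max N₀ M)
      have hNM : M ≤ N := (le_max_right _ _).trans hN
      obtain ⟨q, hq, hqi, hqn⟩ := hw.push hg hpush (N / M + 1)
      set k := N / M + 1 with hk
      refine ⟨N + k, by have := (le_max_left N₀ M).trans hN; exact this.trans (Nat.le_add_right _ _), w + q,
        hq.mono (min_le_left _ _), ?_⟩
      have hk1 : N ≤ M * k := (Nat.lt_mul_div_succ N hM0).le
      have hk2 : M * k ≤ 2 * N := by
        have := Nat.mul_div_le N M
        rw [hk, mul_add]; omega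
      have hN0 : (0 : ℝ) < N := by exact_mod_cast hM0.trans_le hNM
      have hk0 : (0 : ℝ) < k := by positivity
      have hk1' : (N : ℝ) ≤ M * k := by exact_mod_cast hk1
      have hk2' : (M : ℝ) * k ≤ 2 * N := by exact_mod_cast hk2
      set l : ℝ := k / (N + k) with hl
      have hNk : (0 : ℝ) < N + k := by positivity
      have hl0 : 0 < l := by positivity
      have hl1 : l ≤ 1 := by rw [hl, div_le_one hNk]; linarith
      have hlM : 1 / ((M : ℝ) + 1) ≤ l := by
        rw [hl, div_le_div_iff₀ (by positivity) hNk]; linarith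
      have hlM' : M * l ≤ 2 := by
        rw [hl, ← mul_div_assoc, div_le_iff₀ hNk]; linarith
      have key := norm_sub_sq_le_of_push (e := e) (a := ((N + k : ℕ) : ℝ)⁻¹ • (w + q) - s)
        (b := (N : ℝ)⁻¹ • w - s) (q := (k : ℝ)⁻¹ • q - s) (ε := ε₀) (δ := δ) (B := 2 * R)
        hl0.le hl1 ?_ (hd.le.trans (min_le_right _ _)) ?_ ?_
      · have h1 : e - (((N + k : ℕ) : ℝ)⁻¹ • (w + q) - s) = z - ((N + k : ℕ) : ℝ)⁻¹ • (w + q) := by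
          rw [he]; abel
        rw [h1] at key
        have h2 : (l * (2 * R)) ^ 2 ≤ l * δ / 2 := by
          have : 4 * R ^ 2 * l ≤ δ / 2 := by
            have h3 : 16 * R ^ 2 * l ≤ M * δ * l := by gcongr
            nlinarith
          nlinarith
        have h3 : η ≤ l * δ := by
          have := mul_le_mul_of_nonneg_right hlM hδ.le
          rwa [one_div_mul_eq_div] at this
        show ‖z - ((N + k : ℕ) : ℝ)⁻¹ • (w + q)‖ ^ 2 ≤ ‖e‖ ^ 2 - η / 2
        linarith
      · have e1 : (1 - l) = N / (N + k) := by rw [hl]; field_simp; ring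
        have e2 : (1 - l) * (N : ℝ)⁻¹ = (N + k : ℝ)⁻¹ := by rw [e1]; field_simp
        have e3 : l * (k : ℝ)⁻¹ = (N + k : ℝ)⁻¹ := by rw [hl]; field_simp
        rw [smul_sub, smul_sub, smul_smul, smul_smul, e2, e3]
        push_cast
        module
      · refine (norm_sub_le _ _).trans ?_
        rw [norm_smul, norm_inv, Real.norm_of_nonneg hk0.le]
        have : (k : ℝ)⁻¹ * ‖q‖ ≤ R := by rwa [inv_mul_le_iff₀ hk0]
        linarith
      · have : (k : ℝ)⁻¹ • q - s = (k : ℝ)⁻¹ • (q - (k : ℝ) • s) := by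
          rw [smul_sub, smul_smul, inv_mul_cancel₀ hk0.ne', one_smul]
        rw [this, inner_smul_right, le_inv_mul_iff₀ hk0]
        exact hqi)
  have h1 := hmin s' hs'
  have h2 : ‖e‖ ^ 2 ≤ ‖z - s'‖ ^ 2 := by gcongr
  have h3 : ‖z - s'‖ ^ 2 ≤ ‖e‖ ^ 2 - η / 2 := hs'F
  linarith

/-- Blackwell's theorem: a compact set satisfying Blackwell's condition is approachable. -/
theorem IsBlackwellSet.exists_strategy [Nonempty Y] {S : Set V} (hS : IsBlackwellSet g S)
    (hSc : IsCompact S) (hSne : S.Nonempty) (hg : ∀ x y, ‖g x y‖ ≤ R)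
    (hSR : ∀ s ∈ S, ‖s‖ ≤ R) :
    ∃ σ : (t : ℕ) → (Fin t → Y) → X, ∀ y,
      Tendsto (fun n : ℕ => Metric.infDist ((n : ℝ)⁻¹ • playSum g σ y n) S) atTop (𝓝 0) := by
  have hproj : ∀ z, ∃ s ∈ S, Metric.infDist z S = ‖z - s‖ := fun z => by
    obtain ⟨s, hs, h⟩ := hSc.exists_infDist_eq_dist hSne z
    exact ⟨s, hs, by rw [h, dist_eq_norm]⟩
  choose π hπS hπ using hproj
  have hact : ∀ (n : ℕ) (w : V), ∃ x, ∀ y, inner ℝ ((n : ℝ)⁻¹ • w - π ((n : ℝ)⁻¹ • w))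
      (g x y - π ((n : ℝ)⁻¹ • w)) ≤ 1 / ((n : ℝ) + 1) := fun n w =>
    hS _ _ (hπS _) (fun s' hs' => by
      rw [← hπ, ← dist_eq_norm]; exact Metric.infDist_le_dist_of_mem hs') _ (by positivity)
  choose f hf using hact
  obtain ⟨σ, hσ⟩ := exists_strategy_of_feedback g f
  refine ⟨σ, fun y => ?_⟩
  simp only [hσ]
  set W := feedbackState g f y with hW
  -- The constant is the sum of the bound `2` on the cross term, since the slack `1 / (n + 1)` is
  -- multiplied by `2 * n`, and of the bound on the squared increment.
  set c : ℝ := 2 + (2 * R) ^ 2 with hc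
  have hbound : ∀ n : ℕ, (n * Metric.infDist ((n : ℝ)⁻¹ • W n) S) ^ 2 ≤ n * c := by
    intro n
    induction n with
    | zero => simp
    | succ n ih =>
      set v := (n : ℝ)⁻¹ • W n with hv
      have hWn : W n = (n : ℝ) • v := by
        rcases Nat.eq_zero_or_pos n with rfl | hn
        · simp [hW, feedbackState]
        · rw [hv, smul_smul, mul_inv_cancel₀ (by positivity), one_smul]
      set u := g (f n (W n)) (y n) with hu
      have hW1 : W (n + 1) = (n : ℝ) • v + u := by rw [← hWn]; rfl
      have hin : inner ℝ (v - π v) (u - π v) ≤ 1 / ((n : ℝ) + 1) := hf n (W n) (y n)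
      have hle : ((n + 1 : ℕ) : ℝ) * Metric.infDist (((n + 1 : ℕ) : ℝ)⁻¹ • W (n + 1)) S
          ≤ ‖(n : ℝ) • (v - π v) + (u - π v)‖ := by
        have h1 := Metric.infDist_le_dist_of_mem (x := ((n + 1 : ℕ) : ℝ)⁻¹ • W (n + 1)) (hπS v)
        have hpos : (0 : ℝ) < ((n + 1 : ℕ) : ℝ) := by positivity
        refine (mul_le_mul_of_nonneg_left h1 hpos.le).trans (le_of_eq ?_)
        rw [dist_eq_norm]
        nth_rewrite 1 [← Real.norm_of_nonneg hpos.le]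
        rw [← norm_smul, smul_sub, smul_smul, mul_inv_cancel₀ hpos.ne', one_smul, hW1]
        congr 1
        push_cast
        module
      have h0 : 0 ≤ ((n + 1 : ℕ) : ℝ) * Metric.infDist (((n + 1 : ℕ) : ℝ)⁻¹ • W (n + 1)) S :=
        mul_nonneg (by positivity) Metric.infDist_nonneg
      refine (pow_le_pow_left₀ h0 hle 2).trans ?_
      rw [norm_add_sq_real, norm_smul, Real.norm_natCast, ← hπ, real_inner_smul_left]
      have h2 : ‖u - π v‖ ^ 2 ≤ (2 * R) ^ 2 := by
        have : ‖u - π v‖ ≤ 2 * R := by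
          have := norm_sub_le u (π v)
          have := hg (f n (W n)) (y n)
          have := hSR _ (hπS v)
          linarith
        gcongr
      have h3 : (n : ℝ) * inner ℝ (v - π v) (u - π v) ≤ 1 := by
        refine (mul_le_mul_of_nonneg_left hin (by positivity)).trans ?_
        rw [mul_one_div, div_le_one (by positivity)]
        linarith
      push_cast
      linarith
  have hsq : Tendsto (fun n : ℕ => (Metric.infDist ((n : ℝ)⁻¹ • W n) S) ^ 2) atTop (𝓝 0) := by
    refine tendsto_of_tendsto_of_tendsto_of_le_of_le' tendsto_const_nhds
      (tendsto_const_div_atTop_nhds_zero_nat c) (Eventually.of_forall fun n => sq_nonneg _) ?_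
    filter_upwards [eventually_gt_atTop 0] with n hn
    have hn' : (0 : ℝ) < n := by exact_mod_cast hn
    have := hbound n
    rw [le_div_iff₀ hn']
    rw [mul_pow] at this
    nlinarith
  have := hsq.sqrt
  simpa [Real.sqrt_sq Metric.infDist_nonneg] using this

/-- A set which is approachable up to every positive error is approachable. -/
theorem exists_strategy_of_forall_pos [ProperSpace V] [Nonempty Y] (hg : ∀ x y, ‖g x y‖ ≤ R)
    (h : ∀ ε > 0, ∃ σ : (t : ℕ) → (Fin t → Y) → X, ∀ y,
      ∀ᶠ n : ℕ in atTop, Metric.infDist ((n : ℝ)⁻¹ • playSum g σ y n) G ≤ ε) :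
    ∃ σ : (t : ℕ) → (Fin t → Y) → X, ∀ y,
      Tendsto (fun n : ℕ => Metric.infDist ((n : ℝ)⁻¹ • playSum g σ y n) G) atTop (𝓝 0) := by
  have hR : 0 ≤ R := by
    obtain ⟨σ, -⟩ := h 1 one_pos
    obtain ⟨y₀⟩ := ‹Nonempty Y›
    exact (norm_nonneg _).trans (hg (σ 0 fun _ => y₀) y₀)
  obtain ⟨s₀, hs₀, -⟩ := exists_mem_safeLimit (g := g) (G := G) hR isClosed_univ
    fun ε hε N₀ => by
      obtain ⟨σ, hσ⟩ := h ε hε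
      obtain ⟨N, hN, w, hw⟩ := exists_safe hg hσ N₀
      exact ⟨N, hN, w, hw, Set.mem_univ _⟩
  have hSR : ∀ s ∈ safeLimit g G R, ‖s‖ ≤ R := fun s hs =>
    norm_le_of_mem_safeLimit hR hs
  have hSc : IsCompact (safeLimit g G R) :=
    (isCompact_closedBall (0 : V) R).of_isClosed_subset isClosed_safeLimit
      fun s hs => by simpa using hSR s hs
  obtain ⟨σ, hσ⟩ := (isBlackwellSet_safeLimit hR hg).exists_strategy hSc ⟨s₀, hs₀⟩ hg hSR
  refine ⟨σ, fun y => squeeze_zero (fun _ => Metric.infDist_nonneg) (fun n => ?_) (hσ y)⟩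
  obtain ⟨s, hs, hd⟩ := hSc.exists_infDist_eq_dist ⟨s₀, hs₀⟩ ((n : ℝ)⁻¹ • playSum g σ y n)
  rw [hd]
  refine (Metric.infDist_le_infDist_add_dist (y := s)).trans ?_
  rw [safeLimit_infDist hs, zero_add]

end Inner

/-! ### Distances and expansions for all exponents, including those below 1, where the triangle
inequality fails. -/

section LpDist

variable {d : ℕ} {p : ℝ≥0∞}

theorem norm_le_norm_toLp (hp : 0 < p) (v : Fin d → ℝ) : ‖v‖ ≤ ‖WithLp.toLp p v‖ := by
  rcases eq_or_ne p ∞ with rfl | hp'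
  · exact (PiLp.norm_toLp v).ge
  · have hpr : 0 < p.toReal := ENNReal.toReal_pos hp.ne' hp'
    rw [PiLp.norm_eq_sum hpr]
    refine (pi_norm_le_iff_of_nonneg (by positivity)).2 fun i => ?_
    calc ‖v i‖ = (‖v i‖ ^ p.toReal) ^ (1 / p.toReal) := by
          rw [← Real.rpow_mul (norm_nonneg _), mul_one_div_cancel hpr.ne', Real.rpow_one]
      _ ≤ _ := Real.rpow_le_rpow (by positivity)
          (Finset.single_le_sum (f := fun i => ‖v i‖ ^ p.toReal) (fun j _ => by positivity)
            (Finset.mem_univ i)) (by positivity)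

theorem continuous_norm_toLp (hp : 0 < p) :
    Continuous fun v : Fin d → ℝ => ‖WithLp.toLp p v‖ := by
  rcases eq_or_ne p ∞ with rfl | hp'
  · simp only [PiLp.norm_toLp]
    exact continuous_norm
  · have hpr : 0 < p.toReal := ENNReal.toReal_pos hp.ne' hp'
    simp only [PiLp.norm_eq_sum hpr]
    refine Continuous.rpow_const (continuous_finsetSum _ fun i _ => ?_) fun _ =>
      Or.inr (by positivity)
    exact Continuous.rpow_const (by fun_prop) fun _ => Or.inr hpr.le

theorem norm_toLp_nonneg (hp : 0 < p) (v : Fin d → ℝ) : 0 ≤ ‖WithLp.toLp p v‖ :=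
  (norm_nonneg v).trans (norm_le_norm_toLp hp v)

theorem bddBelow_range_norm_toLp_sub (hp : 0 < p) (r : Fin d → ℝ) (C : Set (Fin d → ℝ)) :
    BddBelow (Set.range fun c : C => ‖WithLp.toLp p (r - (c : Fin d → ℝ))‖) :=
  ⟨0, by rintro _ ⟨c, rfl⟩; exact norm_toLp_nonneg hp _⟩

theorem lpDistSet_lt_iff (hp : 0 < p) {C : Set (Fin d → ℝ)} (hC : C.Nonempty) {r : Fin d → ℝ}
    {β : ℝ} : lpDistSet p r C < β ↔ ∃ c ∈ C, ‖WithLp.toLp p (r - c)‖ < β := by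
  have := hC.to_subtype
  rw [lpDistSet, ciInf_lt_iff (bddBelow_range_norm_toLp_sub hp r C)]
  simp

theorem lpDistSet_le (hp : 0 < p) {C : Set (Fin d → ℝ)} {c : Fin d → ℝ} (hc : c ∈ C)
    (r : Fin d → ℝ) : lpDistSet p r C ≤ ‖WithLp.toLp p (r - c)‖ :=
  ciInf_le (bddBelow_range_norm_toLp_sub hp r C) (⟨c, hc⟩ : C)

-- The infimum need not be attained, hence the intersection over `β > α` of the sums of `closure C`
-- and the compact `β`-ball. Continuity of the gauge replaces the triangle inequality.
open scoped Pointwise in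
theorem isClosed_expansion (hp : 0 < p) {C : Set (Fin d → ℝ)} (hC : C.Nonempty) (α : ℝ≥0) :
    IsClosed (expansion p C α) := by
  have hcont := continuous_norm_toLp (d := d) hp
  have hclosed : ∀ β : ℝ, IsClosed (closure C + {v | ‖WithLp.toLp p v‖ ≤ β}) := fun β => by
    refine isClosed_closure.add_right_of_isCompact
      ((isCompact_closedBall (0 : Fin d → ℝ) β).of_isClosed_subset
        (isClosed_le hcont continuous_const) fun v hv => ?_)
    simpa using (norm_le_norm_toLp hp v).trans hv
  have : expansion p C α
      = ⋂ β : Set.Ioi (α : ℝ), (closure C + {v | ‖WithLp.toLp p v‖ ≤ (β : ℝ)}) := by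
    ext r
    simp only [expansion, Set.mem_ofPred_eq, Set.mem_iInter]
    constructor
    · rintro hr ⟨β, hβ⟩
      obtain ⟨c, hc, h⟩ := (lpDistSet_lt_iff hp hC).1 (hr.trans_lt hβ)
      exact Set.mem_add.2 ⟨c, subset_closure hc, r - c, h.le, by abel⟩
    · intro hr
      refine le_of_forall_gt_imp_ge_of_dense fun β hβ => ?_
      obtain ⟨β', h1, h2⟩ := exists_between hβ
      obtain ⟨c, hc, v, hv, rfl⟩ := Set.mem_add.1 (hr ⟨β', h1⟩)
      have hopen : IsOpen {c' : Fin d → ℝ | ‖WithLp.toLp p (c + v - c')‖ < β} :=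
        isOpen_lt (hcont.comp (by fun_prop)) continuous_const
      obtain ⟨c', hc'1, hc'2⟩ := mem_closure_iff.1 hc _ hopen (by
        show ‖WithLp.toLp p (c + v - c)‖ < β
        rw [add_sub_cancel_left]
        exact lt_of_le_of_lt hv h2)
      exact ((lpDistSet_lt_iff hp hC).2 ⟨c', hc'2, hc'1⟩).le
  rw [this]
  exact isClosed_iInter fun β => hclosed β

end LpDist

theorem infDist_image_le {E F : Type*} [NormedAddCommGroup E] [NormedSpace ℝ E]
    [NormedAddCommGroup F] [NormedSpace ℝ F] (L : E →L[ℝ] F) (z : E) (G : Set E) :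
    Metric.infDist (L z) (L '' G) ≤ ‖L‖ * Metric.infDist z G := by
  rcases G.eq_empty_or_nonempty with rfl | hG
  · simp
  have := hG.to_subtype
  rw [Metric.infDist_eq_iInf (s := G), Real.mul_iInf_of_nonneg (norm_nonneg _)]
  refine le_ciInf fun y => (Metric.infDist_le_dist_of_mem (Set.mem_image_of_mem L y.2)).trans ?_
  exact L.dist_le_opNorm _ _

/-- A sequence in a compact set which approaches a closed set `G'` eventually is close to `G` if
the points of `G'` in a neighborhood are. -/
theorem eventually_infDist_le {E : Type*} [PseudoMetricSpace E] {G G' B : Set E}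
    (hG' : G'.Nonempty) {z : ℕ → E} {ε η : ℝ} (hε : 0 < ε) (hη : 0 < η)
    (hB : ∀ n q, dist (z n) q < η → q ∈ B) (hsub : ∀ q ∈ G', q ∈ B → Metric.infDist q G ≤ ε)
    (hz : Tendsto (fun n => Metric.infDist (z n) G') atTop (𝓝 0)) :
    ∀ᶠ n in atTop, Metric.infDist (z n) G ≤ 2 * ε := by
  filter_upwards [hz.eventually_lt_const (lt_min hε hη)] with n hn
  obtain ⟨q, hq, hd⟩ := (Metric.infDist_lt_iff hG').1 hn
  have h1 := hsub q hq (hB n q (hd.trans_le (min_le_right _ _)))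
  have h2 := Metric.infDist_le_infDist_add_dist (s := G) (x := z n) (y := q)
  have h3 := hd.trans_le (min_le_left ε η)
  linarith

/-! ### Transfer of approachability to the game with vector payoffs. -/

section Game

variable {A d : ℕ}

theorem norm_odot_le (x : stdSimplex ℝ (Fin A)) (m : PayoffVec A d) :
    ‖odot (x : Fin A → ℝ) m‖ ≤ ‖m‖ := by
  have hx0 : ∀ a, 0 ≤ x a := x.2.1
  have hx1 : ∑ a, x a = 1 := x.2.2
  refine (norm_sum_le_of_le (f := fun a => x a • m a) _ fun a _ =>
    show _ ≤ x a * ‖m‖ from ?_).trans ?_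
  · rw [norm_smul, Real.norm_of_nonneg (hx0 a)]
    exact mul_le_mul_of_nonneg_left (norm_le_pi_norm m a) (hx0 a)
  · rw [← Finset.sum_mul, hx1, one_mul]

theorem norm_inv_smul_sum_le {F : Type*} [NormedAddCommGroup F] [NormedSpace ℝ F] {f : ℕ → F}
    {B : ℝ} (hB : 0 ≤ B) (hf : ∀ t, ‖f t‖ ≤ B) (T : ℕ) :
    ‖(T : ℝ)⁻¹ • ∑ t ∈ Finset.range T, f t‖ ≤ B := by
  rw [norm_smul, norm_inv, Real.norm_natCast]
  rcases Nat.eq_zero_or_pos T with rfl | hT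
  · simpa
  · rw [inv_mul_le_iff₀ (by positivity)]
    refine (norm_sum_le_of_le _ fun t _ => hf t).trans ?_
    simp

theorem avgVec_mem {K : Set (PayoffVec A d)} (hK : Convex ℝ K) {m : ℕ → PayoffVec A d}
    (hm : ∀ t, m t ∈ K) {T : ℕ} (hT : 0 < T) : avgVec m T ∈ K := by
  rw [avgVec, Finset.smul_sum]
  refine hK.sum_mem (fun _ _ => by positivity) ?_ fun t _ => hm t
  have : (T : ℝ) ≠ 0 := by positivity
  simp [this]

theorem norm_avgVec_le {m : ℕ → PayoffVec A d} {B : ℝ} (hm : ∀ t, ‖m t‖ ≤ B) (T : ℕ) :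
    ‖avgVec m T‖ ≤ B :=
  norm_inv_smul_sum_le ((norm_nonneg _).trans (hm 0)) hm T

theorem norm_avgPayoff_le (σ : Strategy A d) {m : ℕ → PayoffVec A d} {B : ℝ}
    (hm : ∀ t, ‖m t‖ ≤ B) (T : ℕ) : ‖avgPayoff σ m T‖ ≤ B :=
  norm_inv_smul_sum_le ((norm_nonneg _).trans (hm 0))
    (fun t => (norm_odot_le _ _).trans (hm t)) T

/-- In the game with vector payoffs in a bounded set `K`, a set which is approachable up to every
positive error is approachable. -/
theorem exists_strategy_tendsto {K : Set (PayoffVec A d)} (hKne : K.Nonempty) {B : ℝ}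
    (hB : ∀ m ∈ K, ‖m‖ ≤ B) {G : Set (PayoffVec A d × (Fin d → ℝ))}
    (h : ∀ ε > 0, ∃ σ : Strategy A d, ∀ m : ℕ → PayoffVec A d, (∀ t, m t ∈ K) →
      ∀ᶠ T in atTop, Metric.infDist (avgVec m T, avgPayoff σ m T) G ≤ ε) :
    ∃ σ : Strategy A d, ∀ m : ℕ → PayoffVec A d, (∀ t, m t ∈ K) →
      Tendsto (fun T => Metric.infDist (avgVec m T, avgPayoff σ m T) G) atTop (𝓝 0) := by
  classical
  obtain ⟨k₀, hk₀⟩ := hKne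
  have : Nonempty K := ⟨⟨k₀, hk₀⟩⟩
  -- Projections need an inner product, whereas the product carries the sup norm; a linear
  -- isomorphism changes distances by bounded factors only.
  let e := toEuclidean (E := PayoffVec A d × (Fin d → ℝ))
  let L : (PayoffVec A d × (Fin d → ℝ)) →L[ℝ]
      EuclideanSpace ℝ (Fin (Module.finrank ℝ (PayoffVec A d × (Fin d → ℝ)))) := e
  let L' : EuclideanSpace ℝ (Fin (Module.finrank ℝ (PayoffVec A d × (Fin d → ℝ))))
      →L[ℝ] (PayoffVec A d × (Fin d → ℝ)) := e.symm
  let g : stdSimplex ℝ (Fin A) → K →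
      EuclideanSpace ℝ (Fin (Module.finrank ℝ (PayoffVec A d × (Fin d → ℝ)))) := fun x m => L (m, odot x m)
  have hg : ∀ x m, ‖g x m‖ ≤ ‖L‖ * B := fun x m => by
    refine (L.le_opNorm _).trans (mul_le_mul_of_nonneg_left ?_ (norm_nonneg _))
    exact max_le (hB _ m.2) ((norm_odot_le _ _).trans (hB _ m.2))
  have hplay : ∀ (σ : Strategy A d) (τ : (t : ℕ) → (Fin t → K) → stdSimplex ℝ (Fin A)),
      (∀ t (k : Fin t → K), σ t (fun s => k s) = τ t k) → ∀ (y : ℕ → K) (n : ℕ),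
      (n : ℝ)⁻¹ • playSum g τ y n
        = L (avgVec (fun t => (y t : PayoffVec A d)) n,
          avgPayoff σ (fun t => (y t : PayoffVec A d)) n) := by
    intro σ τ hστ y n
    simp only [playSum, g, ← map_sum, ← map_smul]
    congr 1
    simp only [avgVec, avgPayoff, Prod.ext_iff, Prod.smul_fst, Prod.smul_snd, Prod.fst_sum,
      Prod.snd_sum, ← hστ, and_self]
  have hLL : ∀ z, L' (L z) = z := fun z => e.symm_apply_apply z
  have himage : L' '' (L '' G) = G := by
    rw [Set.image_image]; simp [hLL]
  obtain ⟨τ, hτ⟩ := exists_strategy_of_forall_pos (g := g) (G := L '' G) hg fun ε hε => by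
    obtain ⟨σ, hσ⟩ := h (ε / (‖L‖ + 1)) (by positivity)
    refine ⟨fun t k => σ t fun s => k s, fun y => ?_⟩
    filter_upwards [hσ (fun t => y t) fun t => (y t).2] with T hT
    rw [hplay σ _ (fun _ _ => rfl)]
    refine (infDist_image_le L _ _).trans ?_
    have h1 := mul_le_mul_of_nonneg_left hT (norm_nonneg L)
    refine h1.trans ?_
    rw [← mul_div_assoc, div_le_iff₀ (by positivity)]
    nlinarith [norm_nonneg L]
  refine ⟨fun t k => τ t fun s => if hs : k s ∈ K then ⟨k s, hs⟩ else ⟨k₀, hk₀⟩,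
    fun m hm => ?_⟩
  have hτ' := hτ fun t => ⟨m t, hm t⟩
  have hlim := hτ'.const_mul ‖L'‖
  rw [mul_zero] at hlim
  refine squeeze_zero (fun _ => Metric.infDist_nonneg) (fun T => ?_) hlim
  rw [hplay (fun t k => τ t fun s => if hs : k s ∈ K then ⟨k s, hs⟩ else ⟨k₀, hk₀⟩) τ
    (fun t k => by simp)]
  refine le_trans (le_of_eq ?_) (infDist_image_le L' _ _)
  rw [himage, hLL]

end Game

/-! ### Target functions, their graphs and infima. -/

section Target

variable {A d : ℕ} {p : ℝ≥0∞} {C : Set (Fin d → ℝ)} {K : Set (PayoffVec A d)}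

theorem targetGraph_nonempty (hp : 0 < p) (hC : C.Nonempty) (hKne : K.Nonempty) (φ : K → ℝ≥0) :
    (targetGraph p C φ).Nonempty := by
  obtain ⟨c, hc⟩ := hC
  obtain ⟨m, hm⟩ := hKne
  refine ⟨(m, c), hm, (lpDistSet_le hp hc c).trans ?_⟩
  have : ‖WithLp.toLp p (c - c)‖ = 0 := by
    rw [sub_self]
    rcases eq_or_ne p ∞ with rfl | hp'
    · rw [PiLp.norm_toLp, norm_zero]
    · have hpr : 0 < p.toReal := ENNReal.toReal_pos hp.ne' hp'
      rw [PiLp.norm_eq_sum hpr]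
      simp [hpr.ne', Real.zero_rpow]
  rw [this]
  exact NNReal.coe_nonneg _

theorem targetGraph_mono {φ ψ : K → ℝ≥0} (h : φ ≤ ψ) : targetGraph p C φ ⊆ targetGraph p C ψ :=
  fun _ ⟨hz, hr⟩ => ⟨hz, hr.trans (NNReal.coe_le_coe.2 (h _))⟩

theorem isClosed_targetGraph_const (hp : 0 < p) (hC : C.Nonempty) (hK : IsClosed K) (α : ℝ≥0) :
    IsClosed (targetGraph p C fun _ : K => α) := by
  have : targetGraph p C (fun _ : K => α) = K ×ˢ expansion p C α := by
    ext z
    simp [targetGraph]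
  rw [this]
  exact hK.prod (isClosed_expansion hp hC α)

/-- All average payoffs lie in a fixed ball, so a constant bounding the distance from that ball to
one point of `C` is achieved by any strategy. -/
theorem exists_achievable_const (hA : 1 ≤ A) (hp : 0 < p) (hC : C.Nonempty)
    (hKconv : Convex ℝ K) {B : ℝ} (hB : ∀ m ∈ K, ‖m‖ ≤ B) :
    ∃ α : ℝ≥0, Achievable p C fun _ : K => α := by
  obtain ⟨c, hc⟩ := hC
  obtain ⟨α, hα⟩ := (isCompact_closedBall (0 : Fin d → ℝ) B).exists_bound_of_continuousOn
    (f := fun r => ‖WithLp.toLp p (r - c)‖)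
    ((continuous_norm_toLp hp).comp (by fun_prop : Continuous fun r => r - c)).continuousOn
  refine ⟨α.toNNReal, fun _ _ => ⟨Pi.single ⟨0, hA⟩ 1, single_mem_stdSimplex ℝ _⟩, fun m hm => ?_⟩
  refine tendsto_const_nhds.congr' ?_
  -- The average over zero rounds is `0`, which may lie outside `K`.
  filter_upwards [eventually_gt_atTop 0] with T hT
  refine (Metric.infDist_zero_of_mem (show _ ∈ targetGraph p C _ from
    ⟨avgVec_mem hKconv hm hT, ?_⟩)).symm
  refine (lpDistSet_le hp hc _).trans (le_trans ?_ (Real.le_coe_toNNReal α))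
  exact (le_abs_self _).trans (hα _ (by
    simpa using norm_avgPayoff_le _ (fun t => hB _ (hm t)) T))

theorem targetGraph_iInf {ι : Type*} [Nonempty ι] (φ : ι → K → ℝ≥0) :
    targetGraph p C (fun m => ⨅ i, φ i m) = ⋂ i, targetGraph p C (φ i) := by
  ext z
  simp only [Set.mem_iInter]
  constructor
  · rintro h i
    exact targetGraph_mono (fun m => ciInf_le (OrderBot.bddBelow _) i) h
  · intro h
    obtain ⟨hz, -⟩ := h (Classical.arbitrary ι)
    refine ⟨hz, ?_⟩
    have h' : (lpDistSet p z.2 C).toNNReal ≤ ⨅ i, φ i ⟨z.1, hz⟩ := le_ciInf fun i =>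
      Real.toNNReal_le_iff_le_coe.2 (h i).2
    exact Real.toNNReal_le_iff_le_coe.1 h'

/-- The infimum of a directed family of achievable target functions is achievable. -/
theorem achievable_iInf (hp : 0 < p) (hC : C.Nonempty) (hKne : K.Nonempty) {B : ℝ}
    (hB : ∀ m ∈ K, ‖m‖ ≤ B) {ι : Type*} [Nonempty ι] (φ : ι → K → ℝ≥0)
    (hdir : Directed (· ≥ ·) φ) (hclosed : ∀ i, IsClosed (targetGraph p C (φ i)))
    (hach : ∀ i, Achievable p C (φ i)) : Achievable p C (fun m => ⨅ i, φ i m) := by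
  refine exists_strategy_tendsto hKne hB fun ε hε => ?_
  set G := targetGraph p C (fun m => ⨅ i, φ i m) with hG
  -- Otherwise the compact parts of the graphs at distance at least `ε / 2` from `G` form a directed
  -- family of non-empty sets. A common point would be in `G`. The radius `B + 1` covers all points
  -- within 1 of an average.
  obtain ⟨i, hi⟩ : ∃ i, ∀ q ∈ targetGraph p C (φ i), q ∈ Metric.closedBall 0 (B + 1) →
      Metric.infDist q G ≤ ε / 2 := by
    by_contra! hcon
    have hbd : IsClosed {q | ε / 2 ≤ Metric.infDist q G} :=
      isClosed_le continuous_const (Metric.continuous_infDist_pt G)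
    have hcl : ∀ i, IsClosed (targetGraph p C (φ i) ∩
        (Metric.closedBall 0 (B + 1) ∩ {q | ε / 2 ≤ Metric.infDist q G})) := fun i =>
      (hclosed i).inter (Metric.isClosed_closedBall.inter hbd)
    obtain ⟨q, hq⟩ := IsCompact.nonempty_iInter_of_directed_nonempty_isCompact_isClosed
      (fun i => targetGraph p C (φ i) ∩
        (Metric.closedBall 0 (B + 1) ∩ {q | ε / 2 ≤ Metric.infDist q G}))
      (fun i j => by
        obtain ⟨k, hk1, hk2⟩ := hdir i j
        exact ⟨k, Set.inter_subset_inter_left _ (targetGraph_mono hk1),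
          Set.inter_subset_inter_left _ (targetGraph_mono hk2)⟩)
      (fun i => by
        obtain ⟨q, h1, h2, h3⟩ := hcon i
        exact ⟨q, h1, h2, h3.le⟩)
      (fun i => (isCompact_closedBall _ _).of_isClosed_subset (hcl i) fun q hq => hq.2.1) hcl
    rw [Set.mem_iInter] at hq
    have hqG : q ∈ G := by
      rw [hG, targetGraph_iInf, Set.mem_iInter]
      exact fun i => (hq i).1
    have h1 : ε / 2 ≤ Metric.infDist q G := (hq (Classical.arbitrary ι)).2.2
    rw [Metric.infDist_zero_of_mem hqG] at h1
    linarith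
  obtain ⟨σ, hσ⟩ := hach i
  refine ⟨σ, fun m hm => ?_⟩
  have := eventually_infDist_le (G := G) (targetGraph_nonempty hp hC hKne (φ i)) (half_pos hε)
    one_pos (B := Metric.closedBall 0 (B + 1)) ?_ hi (hσ m hm)
  · filter_upwards [this] with T hT
    linarith
  · intro T q hq
    have h1 : ‖(avgVec m T, avgPayoff σ m T)‖ ≤ B :=
      max_le (norm_avgVec_le (fun t => hB _ (hm t)) T) (norm_avgPayoff_le σ (fun t => hB _ (hm t)) T)
    rw [mem_closedBall_zero_iff]
    rw [dist_comm, dist_eq_norm] at hq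
    have h2 := norm_sub_norm_le q (avgVec m T, avgPayoff σ m T)
    linarith

end Target

theorem lemma5 (A d : ℕ) (hA : 1 ≤ A) (hd : 1 ≤ d) (p : ℝ≥0∞) (hp : 0 < p)
    (C : Set (Fin d → ℝ)) (hC : C.Nonempty)
    (K : Set (PayoffVec A d)) (hKne : K.Nonempty) (hKconv : Convex ℝ K)
    (hKbdd : Bornology.IsBounded K) (hKclosed : IsClosed K) :
    ∃ φ : K → ℝ≥0, Admissible p C φ := by
  obtain ⟨B, hB⟩ := hKbdd.exists_norm_le
  let Φ := {φ : K → ℝ≥0 // IsClosed (targetGraph p C φ) ∧ Achievable p C φ}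
  obtain ⟨α, hα⟩ := exists_achievable_const hA hp hC hKconv hB
  have : Nonempty Φ := ⟨⟨fun _ => α, isClosed_targetGraph_const hp hC hKclosed α, hα⟩⟩
  -- Zorn's lemma for the reversed order: maximal means minimal, and the bound of a chain is its
  -- pointwise infimum.
  obtain ⟨φ, hφ⟩ := exists_maximal_of_nonempty_chains_bounded (α := Φ)
    (r := fun φ ψ => ψ.1 ≤ φ.1) (fun c hc hne => by
      have := hne.to_subtype
      have hdir : Directed (· ≥ ·) fun φ : c => φ.1.1 := fun φ ψ => by
        rcases eq_or_ne φ ψ with rfl | hφψ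
        · exact ⟨φ, le_rfl, le_rfl⟩
        · rcases hc φ.2 ψ.2 (Subtype.coe_injective.ne hφψ) with h | h
          · exact ⟨ψ, h, le_rfl⟩
          · exact ⟨φ, le_rfl, h⟩
      refine ⟨⟨fun m => ⨅ φ : c, φ.1.1 m, ?_, achievable_iInf hp hC hKne hB _ hdir
        (fun φ => φ.1.2.1) fun φ => φ.1.2.2⟩, fun φ hφ m => ?_⟩
      · rw [targetGraph_iInf]
        exact isClosed_iInter fun φ => φ.1.2.1
      · exact ciInf_le (OrderBot.bddBelow (Set.range fun φ : c => φ.1.1 m)) (⟨φ, hφ⟩ : c))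
    (fun h1 h2 => h2.trans h1)
  refine ⟨φ.1, φ.2.1, φ.2.2, ?_⟩
  rintro ⟨ψ, hψ1, hψ2, hle, m, hm⟩
  exact hm.not_ge (hφ ⟨ψ, hψ1, hψ2⟩ hle m)
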